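/- For a prime $p$ and a field $F$, let $F(p)$ denote the maximal Galois pro-$p$ extension of $F$, i.e. the compositum of all finite Galois extensions of $F$ of $p$-power degree inside an algebraic closure. A (Krull) valuation $v$ on a field $K$ is called henselian if it has a unique extension (up to equivalence) to an algebraic closure of $K$, and $p$-henselian if it has a unique extension to $K(p)$. A field $F$ is pseudo-algebraically closed (PAC) if every absolutely irreducible variety defined over $F$ has an $F$-rational point, and Hilbertian if every separable Hilbert subset of $F^r$ is nonempty, for all $r$: that is, for any finitely many $f_1,\dots,f_m\in F(T_1,\dots,T_r)[X]$ that are irreducible and separable over $F(T_1,\dots,T_r)$ and any nonzero $g\in F[T_1,\dots,T_r]$ there is $a\in F^r$ such that $g(a)\neq 0$ and every $f_i(a,X)$ is defined and irreducible in $F[X]$. Let $\mathcal{L}_{\rm ring}=\{+,-,\cdot,0,1\}$, let $P_n$ be a unary predicate symbol, interpreted in a field $K$ as the set of $n$-th powers $\{y^n : y\in K\}$, and let $\mathcal{L}_{\rm Mac}=\mathcal{L}_{\rm ring}\cup\{P_n : n\geq 1\}$. An $\exists$-$\emptyset$-formula is a parameter-free formula consisting of existential quantifiers followed by a quantifier-free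 formula. (1) For every prime number $p$ there is an $\exists$-$\emptyset$-formula $\varphi(x)$ in $\mathcal{L}_{\rm ring}\cup\{P_p\}$ such that for every valued field $(K,v)$ for which $v$ is $p$-henselian, $K$ contains a primitive $p$-th root of unity, and the residue field $F$ satisfies ${\rm char}(F)\neq p$ and (a) $F$ is finite, or (b) $F$ is PAC and $F(p)\neq F$, or (c) $F$ is Hilbertian, the formula $\varphi$ defines the valuation ring of $v$ in $K$, i.e. $\varphi(K)=\{x\in K : v(x)\geq 0\}$ (with $v$ written additively). (2) There is an $\exists$-$\emptyset$-formula in $\mathcal{L}_{\rm Mac}$ that defines, in every field $K$ with a henselian valuation $v$ whose residue field $F$ is of characteristic not $2$ and is finite, or PAC with $F(2)\neq F$ (i.e. PAC but not $2$-closed), or Hilbertian, the valuation ring of $v$. -/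

import Mathlib

universe u w

namespace PHens

/-! ### The languages `L_ring ∪ {P_n : n ∈ N}` -/

/-- For every `n ∈ N` one unary predicate symbol `P_n`. -/
inductive PowRel (N : Set ℕ) : ℕ → Type
  | pow (n : ℕ) (hn : n ∈ N) : PowRel N 1

/-- The relational language `{P_n : n ∈ N}`. -/
def powLanguage (N : Set ℕ) : FirstOrder.Language.{0, 0} where
  Functions := fun _ => Empty
  Relations := PowRel N

/-- The language `L_ring ∪ {P_n : n ∈ N}`. -/
abbrev ringPow (N : Set ℕ) : FirstOrder.Language.{0, 0} :=
  FirstOrder.Language.ring.sum (powLanguage N)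

/-- The Macintyre language: the language of rings with a unary predicate symbol `P_n` for every
positive integer `n`. -/
abbrev macintyre : FirstOrder.Language.{0, 0} := ringPow {n | 0 < n}

/-- In a field, `P_n` is interpreted as the set of all `n`-th powers. -/
@[reducible]
def powStructure (N : Set ℕ) (K : Type*) [Field K] : (powLanguage N).Structure K where
  funMap := fun f => f.elim
  RelMap := fun {_} R =>
    match R with
    | PowRel.pow n _ => fun x => ∃ y : K, x 0 = y ^ n

/-- A field as a structure for `L_ring ∪ {P_n : n ∈ N}`. -/
@[reducible]
def ringPowStructure (N : Set ℕ) (K : Type*) [Field K] : (ringPow N).Structure K :=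
  letI := FirstOrder.Ring.compatibleRingOfRing K
  letI := powStructure N K
  FirstOrder.Language.sumStructure _ _ K

/-- The subset of `K` defined by a parameter-free formula in one free variable. -/
def definedSet {N : Set ℕ} (φ : (ringPow N).Formula (Fin 1)) (K : Type*) [Field K] : Set K :=
  letI := ringPowStructure N K
  {x | φ.Realize (fun _ => x)}

/-! ### The maximal Galois pro-`p` extension; henselian and `p`-henselian valuations -/

/-- The maximal Galois pro-`p` extension `K(p)` of `K`: the compositum, inside an algebraic closure,
of all finite Galois extensions of `K` whose degree is a power of `p`. -/
noncomputable def maxProP (p : ℕ) (K : Type*) [Field K] : IntermediateField K (AlgebraicClosure K) :=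
  sSup {L | FiniteDimensional K L ∧ IsGalois K L ∧ ∃ n : ℕ, Module.finrank K L = p ^ n}

/-- The valuation with valuation ring `O` has exactly one extension to `L`, up to equivalence.
Equivalence classes of valuations are represented by their valuation rings. -/
def HasUniqueExtension {K : Type*} [Field K] (O : ValuationSubring K)
    (L : Type*) [Field L] [Algebra K L] : Prop :=
  ∃! O' : ValuationSubring L, O'.comap (algebraMap K L) = O

/-- A valuation is henselian if it extends uniquely to an algebraic closure. -/
def IsHenselian {K : Type*} [Field K] {Γ₀ : Type*} [LinearOrderedCommGroupWithZero Γ₀]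
    (v : Valuation K Γ₀) : Prop :=
  HasUniqueExtension v.valuationSubring (AlgebraicClosure K)

/-- A valuation is `p`-henselian if it extends uniquely to `K(p)`. -/
def IsPHenselian (p : ℕ) {K : Type*} [Field K] {Γ₀ : Type*} [LinearOrderedCommGroupWithZero Γ₀]
    (v : Valuation K Γ₀) : Prop :=
  HasUniqueExtension v.valuationSubring (maxProP p K)

/-- The residue field of a valuation. -/
abbrev ResidueField {K : Type*} [Field K] {Γ₀ : Type*} [LinearOrderedCommGroupWithZero Γ₀]
    (v : Valuation K Γ₀) : Type _ :=
  IsLocalRing.ResidueField v.valuationSubring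

/-! ### PAC and Hilbertian fields -/

/-- `F` is pseudo-algebraically closed: every geometrically integral affine variety over `F` has an
`F`-rational point. (Every variety has a nonempty affine open subvariety, so that nothing is lost
by restricting to affine ones.) -/
def IsPAC (F : Type*) [Field F] : Prop :=
  ∀ (n : ℕ) (I : Ideal (MvPolynomial (Fin n) F)),
    (I.map (MvPolynomial.map (σ := Fin n) (algebraMap F (AlgebraicClosure F)))).IsPrime →
      ∃ a : Fin n → F, ∀ f ∈ I, MvPolynomial.eval a f = 0

/-- `F` is Hilbertian: every separable Hilbert subset of `F ^ r` is nonempty, that is, finitely many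
polynomials in `X` over `F[T_1, …, T_r]` which are irreducible and separable over
`F(T_1, …, T_r)` can be specialised simultaneously to irreducible polynomials in `F[X]`, at a point
outside the zero set of a given nonzero polynomial `g`. (Clearing denominators reduces coefficients
in `F(T_1, …, T_r)` to coefficients in `F[T_1, …, T_r]`.) -/
def IsHilbertian (F : Type*) [Field F] : Prop :=
  ∀ (r m : ℕ) (f : Fin m → Polynomial (MvPolynomial (Fin r) F)) (g : MvPolynomial (Fin r) F),
    g ≠ 0 →
    (∀ i, Irreducible
        ((f i).map (algebraMap _ (FractionRing (MvPolynomial (Fin r) F)))) ∧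
      ((f i).map (algebraMap _ (FractionRing (MvPolynomial (Fin r) F)))).Separable) →
    ∃ a : Fin r → F, MvPolynomial.eval a g ≠ 0 ∧
      ∀ i, Irreducible ((f i).map (MvPolynomial.eval a))

/-- The condition on residue fields: `char F ≠ p`, and `F` is finite, or PAC with `F(p) ≠ F`, or
Hilbertian. -/
def GoodResidueField (p : ℕ) (F : Type*) [Field F] : Prop :=
  ringChar F ≠ p ∧ (Finite F ∨ (IsPAC F ∧ maxProP p F ≠ ⊥) ∨ IsHilbertian F)

end PHens

namespace PHens

section Formula

open FirstOrder FirstOrder.Language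

/-! ### The existential formula -/

/-! The formula says that `x = 1 / (a - 1) - 1 / (b - 1)` with `a`, `b` each zero or not a `p`-th
power. When `p` is a unit of the valuation ring `O`, uniqueness of the extension makes every
one-unit a `p`-th power (`exists_pow_eq_of_hasUniqueExtension`). So an admissible `a` has `a - 1`
outside the maximal ideal, `1 / (a - 1)` lies in `O`, and the formula defines a subset of `O`.

For the reverse inclusion the equation is solved in the residue field `F` and lifted
(`exists_iff_mem_valuationSubring`); residue `0` only needs one non-power `w`, with `n = m = w`.
That every nonzero `c` in `F` is such a difference is `HasNonPowDifferences`. Finite `F`: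
pigeonhole. Otherwise `c = 1 / (n - 1) - 1 / (m - 1)` amounts to `m = ((1 - c) n + c) / (1 + c - c
n)`. Hilbertian `F`: specialise `n = T` so that `X ^ p - n` and `X ^ p - m` (denominator cleared)
both stay irreducible. PAC `F`: find a point on the curve got from `n = w Y ^ p`, `m = w X ^ p`. -/

/-- A term of the language of rings, as a term of `L_ring ∪ {P_n : n ∈ N}`. -/
def ringTerm (N : Set ℕ) {α : Type} (t : Language.ring.Term α) : (ringPow N).Term α :=
  (LHom.sumInl : Language.ring →ᴸ ringPow N).onTerm t

/-- The formula `P_p(t)`. -/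
def powFormula {N : Set ℕ} {p : ℕ} (hp : p ∈ N) {α : Type} {n : ℕ}
    (t : (ringPow N).Term (α ⊕ Fin n)) : (ringPow N).BoundedFormula α n :=
  Relations.boundedFormula₁ (L := ringPow N) (Sum.inr (PowRel.pow p hp)) t

/-- The formula `t = 0 ∨ ¬ P_p(t)`. -/
def zeroOrNotPow {N : Set ℕ} {p : ℕ} (hp : p ∈ N) {α : Type} {n : ℕ}
    (t : Language.ring.Term (α ⊕ Fin n)) : (ringPow N).BoundedFormula α n :=
  ((ringTerm N t).bdEqual (ringTerm N 0)) ⊔ ∼(powFormula hp (ringTerm N t))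

/-- The existential formula saying that `x = 1 / (a - 1) - 1 / (b - 1)` for some `a`, `b` each of
which is zero or not a `p`-th power. -/
def integralFormula {N : Set ℕ} {p : ℕ} (hp : p ∈ N) : (ringPow N).Formula (Fin 1) :=
  let x : Language.ring.Term (Fin 1 ⊕ Fin 2) := Term.var (Sum.inl 0)
  let a : Language.ring.Term (Fin 1 ⊕ Fin 2) := Term.var (Sum.inr 0)
  let b : Language.ring.Term (Fin 1 ⊕ Fin 2) := Term.var (Sum.inr 1)
  -- Denominators are cleared. No clause `a ≠ 1`, `b ≠ 1` is needed, because `1 = 1 ^ p` is a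
  -- nonzero `p`-th power.
  (zeroOrNotPow hp a ⊓ (zeroOrNotPow hp b ⊓
    (ringTerm N (x * ((a + -1) * (b + -1)))).bdEqual (ringTerm N (b + -a)))).ex.ex

theorem isQF_zeroOrNotPow {N : Set ℕ} {p : ℕ} (hp : p ∈ N) {α : Type} {n : ℕ}
    (t : Language.ring.Term (α ⊕ Fin n)) : (zeroOrNotPow hp t).IsQF :=
  (BoundedFormula.IsAtomic.equal _ _).isQF.sup (BoundedFormula.IsAtomic.rel _ _).isQF.not

theorem isExistential_integralFormula {N : Set ℕ} {p : ℕ} (hp : p ∈ N) :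
    (integralFormula hp).IsExistential :=
  .ex (.ex (((isQF_zeroOrNotPow hp _).inf ((isQF_zeroOrNotPow hp _).inf
    (BoundedFormula.IsAtomic.equal _ _).isQF)).isExistential))

/-- The elements which are zero or not a `p`-th power. -/
def ZeroOrNotPow (p : ℕ) {F : Type*} [Field F] (a : F) : Prop :=
  a = 0 ∨ ¬ ∃ y : F, a = y ^ p

theorem mem_definedSet_integralFormula {N : Set ℕ} {p : ℕ} (hp : p ∈ N) {K : Type*} [Field K]
    (x : K) : x ∈ definedSet (integralFormula hp) K ↔
      ∃ a b : K, ZeroOrNotPow p a ∧ ZeroOrNotPow p b ∧ x * ((a - 1) * (b - 1)) = b - a := by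
  let _ := Ring.compatibleRingOfRing K
  let _ := powStructure N K
  let _ : (ringPow N).Structure K := ringPowStructure N K
  have key : ∀ {n : ℕ} (t : Language.ring.Term (Fin 1 ⊕ Fin n)) (v : Fin 1 → K) (xs : Fin n → K),
      (zeroOrNotPow hp t).Realize v xs ↔ ZeroOrNotPow p (t.realize (Sum.elim v xs)) := by
    intro n t v xs
    have hpow : (powFormula hp (ringTerm N t)).Realize v xs ↔
        ∃ y : K, (ringTerm N t).realize (Sum.elim v xs) = y ^ p :=
      BoundedFormula.realize_rel₁
    rw [zeroOrNotPow, BoundedFormula.realize_sup, BoundedFormula.realize_not, hpow,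
      BoundedFormula.realize_bdEqual]
    simp only [ringTerm, LHom.realize_onTerm, Ring.realize_zero, ZeroOrNotPow]
  change (integralFormula hp).Realize (fun _ => x) ↔ _
  simp only [integralFormula, Formula.Realize, BoundedFormula.realize_ex,
    BoundedFormula.realize_inf, key, BoundedFormula.realize_bdEqual, ringTerm,
    LHom.realize_onTerm, Ring.realize_add, Ring.realize_mul, Ring.realize_neg, Ring.realize_one,
    Term.realize_var, Sum.elim_inl, Sum.elim_inr, sub_eq_add_neg]
  rfl

end Formula

/-! ### One-units are `p`-th powers -/

/-- Since `∑ ζ ^ i = 0`, `p = ∑ (1 - ζ ^ i)`, and `1 - ζ` divides every summand; so `1 - ζ` in the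
maximal ideal would force `p` into it. -/
theorem not_valuation_one_sub_lt_one {K : Type*} [Field K] {O : ValuationSubring K} {p : ℕ}
    (hp : p.Prime) {ζ : K} (hζ : IsPrimitiveRoot ζ p) (hpO : O.valuation (p : K) = 1) :
    ¬ O.valuation (1 - ζ) < 1 := by
  intro h
  have hone : O.valuation ζ = 1 := by
    have : O.valuation ζ ^ p = 1 := by rw [← map_pow, hζ.pow_eq_one, map_one]
    exact (pow_eq_one_iff.1 this).resolve_right hp.ne_zero
  have hsum : (p : K) = ∑ i ∈ Finset.range p, (1 - ζ ^ i) := by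
    rw [Finset.sum_sub_distrib, hζ.geom_sum_eq_zero hp.one_lt]
    simp
  rw [hsum] at hpO
  refine (Valuation.map_sum_lt _ one_ne_zero fun i _ => ?_).ne hpO
  rw [← mul_neg_geom_sum, map_mul]
  refine mul_lt_one_of_lt_of_le h (Valuation.map_sum_le _ fun j _ => ?_)
  rw [map_pow, hone, one_pow]

/-- If `a` is no `p`-th power, an automorphism `σ` sends `α` to `ζ α`, and uniqueness makes `σ`
preserve `O'`. As `∏ (α - η) = a - 1` is small, some `α - η` is small, and so is its conjugate `ζ α
- η`. Comparing with `ζ (α - η)` makes `1 - ζ` small, which is impossible. -/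
theorem exists_pow_eq_of_hasUniqueExtension {K M : Type*} [Field K] [Field M] [Algebra K M]
    [Normal K M] {O : ValuationSubring K} (hO : HasUniqueExtension O M) {p : ℕ} (hp : p.Prime)
    {ζ : K} (hζ : IsPrimitiveRoot ζ p) (hpO : O.valuation (p : K) = 1) {a : K}
    (ha : O.valuation (a - 1) < 1) {α : M} (hα : α ^ p = algebraMap K M a) :
    ∃ y : K, a = y ^ p := by
  by_contra hpow
  obtain ⟨O', hO', huniq⟩ := hO
  have hirr : Irreducible (Polynomial.X ^ p - Polynomial.C a) :=
    X_pow_sub_C_irreducible_of_prime hp fun b hb => hpow ⟨b, hb.symm⟩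
  have hmin : minpoly K α = Polynomial.X ^ p - Polynomial.C a :=
    (minpoly.eq_of_irreducible_of_monic hirr (by simp [hα])
      (Polynomial.monic_X_pow_sub_C a hp.ne_zero)).symm
  set z : M := algebraMap K M ζ
  have hz : IsPrimitiveRoot z p := hζ.map_of_injective (algebraMap K M).injective
  obtain ⟨σ, hσ⟩ : ∃ σ : M ≃ₐ[K] M, σ α = z * α := by
    refine (minpoly.exists_algEquiv_of_root' (K := K) (L := M)
      (Algebra.IsAlgebraic.isAlgebraic α) ?_)
    rw [hmin]
    simp [mul_pow, hz.pow_eq_one, hα]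
  have hσO : O'.comap (σ : M →+* M) = O' := by
    apply huniq
    rw [← hO', ValuationSubring.comap_comap]
    congr 1
    ext x
    simp
  have hmemσ : ∀ x : M, σ x ∈ O' ↔ x ∈ O' := fun x => by
    conv_rhs => rw [← hσO]
    rfl
  have hlt : ∀ x : M, O'.valuation x < 1 → O'.valuation (σ x) < 1 := by
    intro x hx
    by_contra! h
    have hx0 : x ≠ 0 := by
      rintro rfl
      simp at h
    have : (σ x)⁻¹ ∈ O' := by
      rw [← O'.valuation_le_one_iff, map_inv₀]
      exact inv_le_one_of_one_le₀ h
    rw [← map_inv₀, hmemσ, ← O'.valuation_le_one_iff, map_inv₀] at this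
    rw [inv_le_one₀ (by simpa [zero_lt_iff] using hx0)] at this
    exact absurd hx this.not_gt
  have hmem : ∀ x : K, algebraMap K M x ∈ O' ↔ x ∈ O := fun x => by
    conv_rhs => rw [← hO']
    rfl
  have hKlt : ∀ x : K, O.valuation x < 1 ↔ O'.valuation (algebraMap K M x) < 1 := by
    intro x
    rcases eq_or_ne x 0 with rfl | hx
    · simp
    have h1 : ∀ (L : Type _) [Field L] (A : ValuationSubring L) (y : L), y ≠ 0 →
        (A.valuation y < 1 ↔ y⁻¹ ∉ A) := by
      intro L _ A y hy
      rw [← A.valuation_le_one_iff, map_inv₀, inv_le_one₀ (by simpa [zero_lt_iff] using hy),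
        not_le]
    have h2 : O.valuation x < 1 ↔ x⁻¹ ∉ O := by
      rw [← O.valuation_le_one_iff, map_inv₀, inv_le_one₀ (by simpa [zero_lt_iff] using hx),
        not_le]
    rw [h2, h1 M O' _ (by simpa using hx), ← map_inv₀, hmem]
  have hprod : ∏ η ∈ Polynomial.nthRootsFinset p (1 : M), O'.valuation (α - η) < 1 := by
    have h := hz.pow_sub_pow_eq_prod_sub_mul α 1 hp.pos
    simp only [mul_one, one_pow, hα] at h
    rw [← map_prod, ← h, ← map_one (algebraMap K M), ← map_sub]
    exact (hKlt _).1 ha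
  obtain ⟨η, hη, hlt1⟩ : ∃ η ∈ Polynomial.nthRootsFinset p (1 : M), O'.valuation (α - η) < 1 := by
    by_contra! h
    exact absurd hprod (Finset.one_le_prod' h).not_gt
  have hηp : η ^ p = 1 := (Polynomial.mem_nthRootsFinset hp.pos 1).1 hη
  have := NeZero.mk hp.ne_zero
  obtain ⟨i, -, hi⟩ := hz.eq_pow_of_pow_eq_one hηp
  have hση : σ η = η := by
    rw [← hi, map_pow, σ.commutes]
  have hval : ∀ {y : M}, y ^ p = 1 → O'.valuation y = 1 := fun {y} hy => by
    have : O'.valuation y ^ p = 1 := by rw [← map_pow, hy, map_one]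
    exact (pow_eq_one_iff.1 this).resolve_right hp.ne_zero
  refine not_valuation_one_sub_lt_one hp hζ hpO ((hKlt _).2 ?_)
  have h1 : O'.valuation (z * (α - η) - σ (α - η)) < 1 :=
    Valuation.map_sub_lt _ (by rwa [map_mul, hval hz.pow_eq_one, one_mul]) (hlt _ hlt1)
  have h2 : z * (α - η) - σ (α - η) = η * algebraMap K M (1 - ζ) := by
    rw [map_sub σ, hσ, hση, map_sub, map_one]
    ring
  rwa [h2, map_mul, hval hηp, one_mul] at h1

/-- A one-unit of a valuation with a unique extension to `K(p)` is a `p`-th power. -/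
theorem IsPHenselian.exists_pow_eq {p : ℕ} (hp : p.Prime) {K : Type*} [Field K] {Γ₀ : Type*}
    [LinearOrderedCommGroupWithZero Γ₀] {v : Valuation K Γ₀} (hv : IsPHenselian p v)
    {ζ : K} (hζ : IsPrimitiveRoot ζ p) (hpO : v.valuationSubring.valuation (p : K) = 1) {a : K}
    (ha : v.valuationSubring.valuation (a - 1) < 1) : ∃ y : K, a = y ^ p := by
  by_contra hpow
  have : Normal K (maxProP p K) := by
    rw [maxProP, sSup_eq_iSup']
    exact IntermediateField.normal_iSup (h := fun L => (L.2.2.1).to_normal) _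
  have hirr : Irreducible (Polynomial.X ^ p - Polynomial.C a) :=
    X_pow_sub_C_irreducible_of_prime hp fun b hb => hpow ⟨b, hb.symm⟩
  obtain ⟨α, hα⟩ := IsAlgClosed.exists_pow_nat_eq (algebraMap K (AlgebraicClosure K) a) hp.pos
  have hroots : (primitiveRoots p K).Nonempty := ⟨ζ, (mem_primitiveRoots hp.pos).2 hζ⟩
  have hint : IsIntegral K α := Algebra.IsIntegral.isIntegral α
  let L : IntermediateField K (AlgebraicClosure K) := IntermediateField.adjoin K {α}
  have hmin : minpoly K α = Polynomial.X ^ p - Polynomial.C a :=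
    (minpoly.eq_of_irreducible_of_monic hirr (by simp [hα])
      (Polynomial.monic_X_pow_sub_C a hp.ne_zero)).symm
  have : FiniteDimensional K L := IntermediateField.adjoin.finiteDimensional hint
  have hfr : Module.finrank K L = p := by
    rw [IntermediateField.adjoin.finrank hint, hmin, Polynomial.natDegree_X_pow_sub_C]
  -- By Kummer theory `K(α)` is Galois of degree `p` over `K`, hence one of the fields generating
  -- `K(p)`.
  have hL : L ≤ maxProP p K := by
    refine le_sSup ⟨inferInstance, ?_, 1, by rw [hfr, pow_one]⟩
    have hsplit : Polynomial.IsSplittingField K L (Polynomial.X ^ p - Polynomial.C a) := by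
      have := isSplittingField_X_pow_sub_C_of_root_adjoin_eq_top (K := K) (L := L)
        (by rwa [hfr]) (a := a) (α := IntermediateField.AdjoinSimple.gen K α)
        (by
          rw [hfr]
          apply (algebraMap L (AlgebraicClosure K)).injective
          simpa using hα)
        (by
          apply IntermediateField.lift_injective
          rw [IntermediateField.lift_adjoin_simple, IntermediateField.lift_top]
          rfl)
      rwa [hfr] at this
    exact isGalois_of_isSplittingField_X_pow_sub_C hroots hirr L
  exact hpow (exists_pow_eq_of_hasUniqueExtension hv hp hζ hpO ha
    (α := ⟨α, hL (IntermediateField.mem_adjoin_simple_self K α)⟩) (Subtype.ext hα))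

/-! ### Differences `1 / (n - 1) - 1 / (m - 1)` with `n`, `m` not `p`-th powers -/

/-- There are elements that are not `p`-th powers, and every nonzero element is of the form
`1 / (n - 1) - 1 / (m - 1)` with `n` and `m` zero or not a `p`-th power. -/
def HasNonPowDifferences (p : ℕ) (F : Type*) [Field F] : Prop :=
  (∃ w : F, ¬ ∃ y : F, w = y ^ p) ∧ ∀ c : F, c ≠ 0 →
    ∃ n m : F, ZeroOrNotPow p n ∧ ZeroOrNotPow p m ∧ c * ((n - 1) * (m - 1)) = m - n

/-- For `c = 1` the numerator `(1 - c) n + c` of `m` is constant, so Eisenstein's criterion has no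
root to work at. Swapping `n` and `m` reduces this case to `c = -1`; in characteristic 2 the pair
`w`, `w⁻¹` works. -/
theorem HasNonPowDifferences.of_ne_one {p : ℕ} (hp : p ≠ 0) {F : Type*} [Field F]
    (hw : ∃ w : F, ¬ ∃ y : F, w = y ^ p)
    (h : ∀ c : F, c ≠ 0 → c ≠ 1 →
      ∃ n m : F, ZeroOrNotPow p n ∧ ZeroOrNotPow p m ∧ c * ((n - 1) * (m - 1)) = m - n) :
    HasNonPowDifferences p F := by
  refine ⟨hw, fun c hc => ?_⟩
  by_cases hc1 : c = 1
  · subst hc1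
    by_cases h2 : (-1 : F) = 1
    · obtain ⟨w, hw⟩ := hw
      by_cases hw0 : w = 0
      · exact absurd ⟨0, hw0.trans (zero_pow hp).symm⟩ hw
      refine ⟨w, w⁻¹, Or.inr hw,
        Or.inr fun ⟨y, hy⟩ => hw ⟨y⁻¹, by rw [inv_pow, ← hy, inv_inv]⟩, ?_⟩
      field_simp
      linear_combination (1 - w) * h2
    · obtain ⟨n, m, hn, hm, e⟩ := h (-1) (by simp) h2
      exact ⟨m, n, hm, hn, by linear_combination -e⟩
  · exact h c hc hc1

theorem HasNonPowDifferences.of_finite {p : ℕ} (hp : p.Prime) {F : Type*} [Field F] [Finite F]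
    {ζ : F} (hζ : IsPrimitiveRoot ζ p) : HasNonPowDifferences p F := by
  classical
  have := Fintype.ofFinite F
  obtain ⟨w, hw⟩ : ∃ w : F, ¬ ∃ y : F, w = y ^ p := by
    by_contra! h
    have hinj : Function.Injective fun y : F => y ^ p :=
      Finite.injective_iff_surjective.2 fun w => (h w).imp fun y hy => hy.symm
    exact hζ.ne_one hp.one_lt (hinj (by simp [hζ.pow_eq_one]))
  have hw0 : w ≠ 0 := by
    rintro rfl
    exact hw ⟨0, (zero_pow hp.ne_zero).symm⟩
  let Q : Finset F := {n | ZeroOrNotPow p n}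
  have hQ1 : ∀ n ∈ Q, n - 1 ≠ 0 := by
    intro n hn h
    rw [sub_eq_zero] at h
    subst h
    rcases (Finset.mem_filter.1 hn).2 with h | h
    · exact one_ne_zero h
    · exact h ⟨1, (one_pow p).symm⟩
  have hcard : Fintype.card F < 2 * Q.card := by
    -- Multiplication by `w` maps nonzero `p`-th powers injectively to nonzero non-powers. Since `0`
    -- also lies in `Q`, more than half of `F` lies in `Q`.
    have hle : (Qᶜ).card ≤ (Q.erase 0).card := by
      refine Finset.card_le_card_of_injOn (fun y => w * y) ?_ (fun a _ b _ h => mul_left_cancel₀ hw0 h)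
      intro y hy
      have hy' : y ≠ 0 ∧ ∃ z, y = z ^ p := by simpa [Q, ZeroOrNotPow] using hy
      obtain ⟨hy0, z, rfl⟩ := hy'
      have hz0 : z ≠ 0 := by
        rintro rfl
        exact hy0 (zero_pow hp.ne_zero)
      refine Finset.mem_coe.2 (Finset.mem_erase.2 ⟨mul_ne_zero hw0 hy0,
        Finset.mem_filter.2 ⟨Finset.mem_univ _, Or.inr fun ⟨y, e⟩ => hw ⟨y / z, ?_⟩⟩⟩)
      rw [div_pow, ← e]
      field_simp
    have h0 : (0 : F) ∈ Q := Finset.mem_filter.2 ⟨Finset.mem_univ _, Or.inl rfl⟩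
    have h1 := Finset.card_erase_lt_of_mem h0
    have h2 := Finset.card_add_card_compl Q
    omega
  refine ⟨⟨w, hw⟩, fun c hc => ?_⟩
  let D : Finset F := Q.image fun n => (n - 1)⁻¹
  have hD : D.card = Q.card := Finset.card_image_of_injective _ fun a b h => by simpa using h
  let E : Finset F := D.image fun d => c + d
  have hE : E.card = D.card := Finset.card_image_of_injective _ (add_right_injective c)
  -- `D` and its translate `c + D` each fill more than half of `F`, so they meet.
  obtain ⟨a, ha⟩ : (D ∩ E).Nonempty := by
    have h1 := Finset.card_union_add_card_inter D E
    have h2 := Finset.card_le_univ (D ∪ E)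
    exact Finset.card_pos.1 (by omega)
  obtain ⟨haD, haE⟩ := Finset.mem_inter.1 ha
  obtain ⟨n, hn, rfl⟩ := Finset.mem_image.1 haD
  obtain ⟨d, hd, e⟩ := Finset.mem_image.1 haE
  obtain ⟨m, hm, rfl⟩ := Finset.mem_image.1 hd
  refine ⟨n, m, (Finset.mem_filter.1 hn).2, (Finset.mem_filter.1 hm).2, ?_⟩
  have h1 := hQ1 n hn
  have h2 := hQ1 m hm
  have e' : c = (n - 1)⁻¹ - (m - 1)⁻¹ := by rw [← e]; ring
  rw [e']
  field_simp
  ring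

/-! ### Irreducible binomials and Hilbertian residue fields -/

open Polynomial in
-- Eisenstein at `P`; coprimality keeps `B` out of `P` and makes the polynomial primitive.
theorem irreducible_C_mul_X_pow_sub_C {R : Type*} [CommRing R] [IsDomain R] {A B : R}
    (hAB : IsCoprime A B) {P : Ideal R} (hP : P.IsPrime) (hA : A ∈ P) (hA2 : A ∉ P ^ 2) {p : ℕ}
    (hp : 0 < p) : Irreducible (C B * X ^ p - C A) := by
  have hB : B ∉ P := fun hB => by
    obtain ⟨u, v, h⟩ := hAB
    exact hP.ne_top ((Ideal.eq_top_iff_one _).2 (h ▸ P.add_mem (P.mul_mem_left u hA)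
      (P.mul_mem_left v hB)))
  have hB0 : B ≠ 0 := fun h => hB (h ▸ P.zero_mem)
  have hdeg : degree (C A) < degree (C B * X ^ p) := by
    rw [degree_C_mul_X_pow p hB0]
    exact degree_C_le.trans_lt (by exact_mod_cast hp)
  have hd : degree (C B * X ^ p - C A) = p := by
    rw [degree_sub_eq_left_of_degree_lt hdeg, degree_C_mul_X_pow p hB0]
  have hcoeff : ∀ n, n ≠ 0 → n ≠ p → (C B * X ^ p - C A).coeff n = 0 := fun n h0 hn => by
    simp [coeff_C, coeff_X_pow, h0, hn]
  have hc0 : (C B * X ^ p - C A).coeff 0 = -A := by simp [coeff_X_pow, hp.ne]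
  have hcp : (C B * X ^ p - C A).coeff p = B := by simp [coeff_C, hp.ne']
  refine irreducible_of_eisenstein_criterion hP ?_ ?_ ?_ ?_ ?_
  · rwa [leadingCoeff, natDegree_eq_of_degree_eq_some hd, hcp]
  · intro n hn
    rw [hd] at hn
    rcases eq_or_ne n 0 with rfl | h0
    · rw [hc0]
      exact P.neg_mem hA
    · rw [hcoeff n h0 (by rintro rfl; exact lt_irrefl _ hn)]
      exact P.zero_mem
  · rw [hd]
    exact_mod_cast hp
  · rwa [hc0, neg_mem_iff]
  · intro r hr
    rw [C_dvd_iff_dvd_coeff] at hr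
    have h1 : r ∣ A := by simpa [hc0] using hr 0
    have h2 : r ∣ B := by simpa [hcp] using hr p
    exact hAB.isUnit_of_dvd' h1 h2

/-- The polynomial `(α' T ^ k + β') X ^ p - (α T ^ k + β)` over `F[T]`. -/
noncomputable def binomialPoly {F : Type*} [Field F] (α β α' β' : F) (k p : ℕ) :
    Polynomial (MvPolynomial (Fin 1) F) :=
  Polynomial.C (MvPolynomial.C α' * MvPolynomial.X 0 ^ k + MvPolynomial.C β') * Polynomial.X ^ p -
    Polynomial.C (MvPolynomial.C α * MvPolynomial.X 0 ^ k + MvPolynomial.C β)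

open MvPolynomial in
-- Eisenstein at the point `T = r`: `hd` makes `r` a simple root of the constant term, and the
-- nonzero determinant `hdet` gives the Bézout relation between the two coefficients.
theorem irreducible_binomialPoly {F : Type*} [Field F] {α β α' β' r : F} {k p : ℕ}
    (hdet : α' * β - α * β' ≠ 0) (hr : α * r ^ k + β = 0) (hd : α * (k * r ^ (k - 1)) ≠ 0)
    (hp : 0 < p) : Irreducible (binomialPoly α β α' β' k p) := by
  let ev : MvPolynomial (Fin 1) F →+* F := eval fun _ => r
  refine irreducible_C_mul_X_pow_sub_C ?_ (RingHom.ker_isPrime ev) ?_ ?_ hp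
  · refine ⟨C ((α' * β - α * β')⁻¹ * α'), -C ((α' * β - α * β')⁻¹ * α), ?_⟩
    have h : C ((α' * β - α * β')⁻¹) * C (α' * β - α * β') = (1 : MvPolynomial (Fin 1) F) := by
      rw [← C_mul, inv_mul_cancel₀ hdet, C_1]
    rw [← h]
    simp only [C_mul, C_sub]
    ring
  · simpa [RingHom.mem_ker, ev] using hr
  · intro hmem
    -- By the Leibniz rule, derivatives of elements of `P ^ 2` vanish at `r`.
    have hder : ∀ f ∈ RingHom.ker ev ^ 2, ev (pderiv 0 f) = 0 := by
      intro f hf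
      rw [pow_two] at hf
      refine Submodule.mul_induction_on hf (fun a ha b hb => ?_) (fun a b ha hb => ?_)
      · rw [RingHom.mem_ker] at ha hb
        rw [Derivation.leibniz]
        simp [ha, hb]
      · rw [map_add, map_add, ha, hb, add_zero]
    apply hd
    simpa [ev, pderiv_C_mul, Derivation.leibniz_pow] using hder _ hmem

theorem not_exists_pow_of_irreducible {F : Type*} [Field F] {a b : F} (hb : b ≠ 0) {p : ℕ}
    (hp : 1 < p) (h : Irreducible (Polynomial.C b * Polynomial.X ^ p - Polynomial.C a)) :
    ¬ ∃ y : F, a / b = y ^ p := by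
  rintro ⟨y, hy⟩
  have h1 := Polynomial.degree_eq_one_of_irreducible_of_root h (x := y) (by
    simp only [Polynomial.IsRoot, Polynomial.eval_sub, Polynomial.eval_mul, Polynomial.eval_C,
      Polynomial.eval_pow, Polynomial.eval_X, ← hy]
    field_simp
    ring)
  have hdeg : Polynomial.degree (Polynomial.C a) <
      Polynomial.degree (Polynomial.C b * Polynomial.X ^ p) := by
    rw [Polynomial.degree_C_mul_X_pow p hb]
    exact Polynomial.degree_C_le.trans_lt (by exact_mod_cast (by omega : 0 < p))
  rw [Polynomial.degree_sub_eq_left_of_degree_lt hdeg, Polynomial.degree_C_mul_X_pow p hb] at h1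
  have : p = 1 := by exact_mod_cast h1
  omega

theorem map_eval_binomialPoly {F : Type*} [Field F] (α β α' β' : F) (k p : ℕ) (a : Fin 1 → F) :
    (binomialPoly α β α' β' k p).map (MvPolynomial.eval a) =
      Polynomial.C (α' * a 0 ^ k + β') * Polynomial.X ^ p - Polynomial.C (α * a 0 ^ k + β) := by
  simp [binomialPoly]

/-- Gauss's lemma carries irreducibility to `F(T)`; separability then only needs a nonzero
derivative, which holds as `p ≠ 0` in `F`. -/
theorem irreducible_and_separable_map_binomialPoly {F : Type*} [Field F] {α β α' β' r : F} {k p : ℕ}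
    (hdet : α' * β - α * β' ≠ 0) (hr : α * r ^ k + β = 0) (hd : α * (k * r ^ (k - 1)) ≠ 0)
    (hB : α' ≠ 0 ∨ β' ≠ 0) (hk : k ≠ 0)
    (hp : 0 < p) (hpF : (p : F) ≠ 0) :
    Irreducible ((binomialPoly α β α' β' k p).map
        (algebraMap _ (FractionRing (MvPolynomial (Fin 1) F)))) ∧
      ((binomialPoly α β α' β' k p).map
        (algebraMap _ (FractionRing (MvPolynomial (Fin 1) F)))).Separable := by
  have hirr := irreducible_binomialPoly (p := p) hdet hr hd hp
  set L := FractionRing (MvPolynomial (Fin 1) F)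
  have hB0 : (MvPolynomial.C α' * MvPolynomial.X 0 ^ k + MvPolynomial.C β' :
      MvPolynomial (Fin 1) F) ≠ 0 := by
    intro h
    have h0 := congrArg (MvPolynomial.eval fun _ => 0) h
    have h1 := congrArg (MvPolynomial.eval fun _ => 1) h
    simp [hk] at h0 h1
    simp [h0] at h1
    simp [h0, h1] at hB
  have hdeg : (binomialPoly α β α' β' k p).natDegree ≠ 0 := by
    intro h
    have h1 : (binomialPoly α β α' β' k p).coeff p = 0 :=
      Polynomial.coeff_eq_zero_of_natDegree_lt (by omega)
    rw [binomialPoly] at h1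
    simp only [Polynomial.coeff_sub, Polynomial.coeff_C_mul, Polynomial.coeff_X_pow_self,
      Polynomial.coeff_C_of_ne_zero hp.ne', mul_one, sub_zero] at h1
    exact hB0 h1
  have hirr' : Irreducible ((binomialPoly α β α' β' k p).map (algebraMap _ L)) :=
    ((hirr.isPrimitive hdeg).irreducible_iff_irreducible_map_fraction_map).1 hirr
  refine ⟨hirr', ?_⟩
  have hpL : (p : L) ≠ 0 := by
    have := (map_ne_zero (algebraMap F L)).2 hpF
    rwa [map_natCast] at this
  rw [Polynomial.separable_iff_derivative_ne_zero hirr']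
  intro h
  rw [binomialPoly, Polynomial.map_sub, Polynomial.map_mul, Polynomial.map_pow, Polynomial.map_C,
    Polynomial.map_C, Polynomial.map_X, Polynomial.derivative_sub, Polynomial.derivative_C,
    sub_zero, Polynomial.derivative_C_mul_X_pow, mul_eq_zero, Polynomial.C_eq_zero, mul_eq_zero] at h
  rcases h with (h | h) | h
  · exact hB0 ((map_eq_zero_iff _ (IsFractionRing.injective _ L)).1 h)
  · exact hpL h
  · exact pow_ne_zero _ Polynomial.X_ne_zero h

theorem HasNonPowDifferences.of_isHilbertian {p : ℕ} (hp : p.Prime) {F : Type*} [Field F]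
    (hpF : (p : F) ≠ 0) (hF : IsHilbertian F) : HasNonPowDifferences p F := by
  have h0 := irreducible_and_separable_map_binomialPoly (F := F) (α := 1) (β := 0) (α' := 0)
    (β' := 1) (r := 0) (k := 1) (p := p) (by simp) (by simp) (by simp) (by simp) one_ne_zero hp.pos hpF
  refine .of_ne_one hp.ne_zero ?_ fun c hc hc1 => ?_
  · obtain ⟨a, -, ha⟩ := hF 1 1 (fun _ => binomialPoly 1 0 0 1 1 p) 1 one_ne_zero fun _ => h0
    have := ha 0
    rw [map_eval_binomialPoly] at this
    exact ⟨_, not_exists_pow_of_irreducible (by simp) hp.one_lt this⟩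
  · have hc1' : 1 - c ≠ 0 := sub_ne_zero.2 (Ne.symm hc1)
    have h1 := irreducible_and_separable_map_binomialPoly (F := F) (α := 1 - c) (β := c) (α' := -c)
      (β' := 1 + c) (r := -c / (1 - c)) (k := 1) (p := p)
      (by rw [show -c * c - (1 - c) * (1 + c) = -1 by ring]; simp)
      (by field_simp; ring) (by simpa using hc1') (Or.inl (neg_ne_zero.2 hc)) one_ne_zero hp.pos hpF
    -- The two polynomials have as roots the `p`-th roots of `n = T` and of `m`; `g` is the
    -- denominator of `m`.
    obtain ⟨a, hga, ha⟩ := hF 1 2 ![binomialPoly 1 0 0 1 1 p, binomialPoly (1 - c) c (-c) (1 + c) 1 p]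
      (MvPolynomial.C (-c) * MvPolynomial.X 0 + MvPolynomial.C (1 + c)) (by
        intro h
        have h0 := congrArg (MvPolynomial.eval fun _ => 1) h
        simp at h0) (by
        intro i
        fin_cases i
        exacts [h0, h1])
    have ha0 := ha 0
    have ha1 := ha 1
    simp only [Matrix.cons_val_zero, Matrix.cons_val_one] at ha0 ha1
    rw [map_eval_binomialPoly] at ha0 ha1
    have hga' : -c * a 0 + (1 + c) ≠ 0 := by simpa using hga
    refine ⟨a 0, ((1 - c) * a 0 + c) / (-c * a 0 + (1 + c)), Or.inr ?_, Or.inr ?_, ?_⟩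
    · simpa using not_exists_pow_of_irreducible (by simp) hp.one_lt ha0
    · simpa using not_exists_pow_of_irreducible (by simpa using hga') hp.one_lt ha1
    · have hm := div_mul_cancel₀ ((1 - c) * a 0 + c) hga'
      exact mul_right_cancel₀ hga' (by linear_combination (c * (a 0 - 1) - 1) * hm)

/-! ### PAC residue fields -/

/-- If every element of `F` is a `p`-th power and `F` contains a primitive `p`-th root of unity,
then `F` has no proper Galois extension of `p`-power degree. -/
theorem maxProP_eq_bot {p : ℕ} (hp : p.Prime) {F : Type*} [Field F] {ζ : F}
    (hζ : IsPrimitiveRoot ζ p) (h : ∀ a : F, ∃ y : F, a = y ^ p) : maxProP p F = ⊥ := by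
  refine le_bot_iff.1 (sSup_le fun L ⟨hfin, hgal, n, hn⟩ => ?_)
  rcases n with _ | n
  · rw [pow_zero] at hn
    exact (IntermediateField.finrank_eq_one_iff.1 hn).le
  exfalso
  have := Fact.mk hp
  have hG : Nat.card Gal(L/F) = p ^ (n + 1) := by rw [IsGalois.card_aut_eq_finrank, hn]
  -- A subgroup of index `p` in a `p`-group is normal. Its fixed field is cyclic of degree `p` over
  -- `F`, so Kummer theory yields an irreducible `X ^ p - a`, against `h`.
  obtain ⟨H, hH⟩ := Sylow.exists_subgroup_card_pow_prime (G := Gal(L/F)) p (n := n)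
    (by rw [hG]; exact pow_dvd_pow p n.le_succ)
  have hidx : H.index = p := by
    have := H.card_mul_index
    rw [hH, hG, pow_succ] at this
    exact Nat.eq_of_mul_eq_mul_left (pow_pos hp.pos n) this
  have hnormal : H.Normal := Subgroup.normal_of_index_eq_minFac_card
    (by rw [hidx, hG, hp.pow_minFac n.succ_ne_zero])
  let E := IntermediateField.fixedField H
  have hE : Module.finrank F E = p := by
    have h1 := IntermediateField.finrank_fixedField_eq_card H
    have h2 := Module.finrank_mul_finrank F E L
    rw [h1, hn, hH, pow_succ, mul_comm] at h2
    exact Nat.eq_of_mul_eq_mul_left (pow_pos hp.pos n) h2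
  have hEgal : IsGalois F E := IsGalois.of_fixedField_normal_subgroup H
  have hcyc : IsCyclic Gal(E/F) :=
    isCyclic_of_prime_card (p := p) (by rw [IsGalois.card_aut_eq_finrank, hE])
  have hroots : (primitiveRoots (Module.finrank F E) F).Nonempty := by
    rw [hE]
    exact ⟨ζ, (mem_primitiveRoots hp.pos).2 hζ⟩
  have htfae := (isCyclic_tfae F E hroots).out 0 1 rfl rfl
  obtain ⟨a, ha, -⟩ := htfae.1 ⟨hEgal, hcyc⟩
  rw [hE] at ha
  obtain ⟨y, rfl⟩ := h a
  exact not_exists_pow_of_irreducible (b := 1) one_ne_zero hp.one_lt (by simpa using ha)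
    ⟨y, div_one _⟩

theorem HasNonPowDifferences.of_isPAC {p : ℕ} (hp : p.Prime) {F : Type*} [Field F] {ζ : F}
    (hζ : IsPrimitiveRoot ζ p) (hpF : (p : F) ≠ 0) (hF : IsPAC F) (hbot : maxProP p F ≠ ⊥) :
    HasNonPowDifferences p F := by
  obtain ⟨w, hw⟩ : ∃ w : F, ¬ ∃ y : F, w = y ^ p := by
    by_contra! h
    exact hbot (maxProP_eq_bot hp hζ h)
  have hw0 : w ≠ 0 := by
    rintro rfl
    exact hw ⟨0, (zero_pow hp.ne_zero).symm⟩
  refine .of_ne_one hp.ne_zero ⟨w, hw⟩ fun c hc hc1 => ?_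
  have hc1' : 1 - c ≠ 0 := sub_ne_zero.2 (Ne.symm hc1)
  -- The relation between `n` and `m` after substituting `n = w * X₁ ^ p`, `m = w * X₀ ^ p`.
  let f : MvPolynomial (Fin 2) F :=
    (MvPolynomial.C (-c * w ^ 2) * MvPolynomial.X 1 ^ p + MvPolynomial.C ((1 + c) * w)) *
      MvPolynomial.X 0 ^ p -
    (MvPolynomial.C ((1 - c) * w) * MvPolynomial.X 1 ^ p + MvPolynomial.C c)
  let φ := algebraMap F (AlgebraicClosure F)
  have hprime : ((Ideal.span {f}).map (MvPolynomial.map (σ := Fin 2) φ)).IsPrime := by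
    -- `r` is a root of the constant term of `f` in `X₀`; it is simple because `r ≠ 0` and `p ≠ 0`.
    obtain ⟨r, hr⟩ := IsAlgClosed.exists_pow_nat_eq (φ (-c / ((1 - c) * w))) hp.pos
    have hr0 : r ≠ 0 := by
      rintro rfl
      rw [zero_pow hp.ne_zero] at hr
      have := (map_eq_zero φ).1 hr.symm
      simp [hc, hc1', hw0] at this
    have hirr := irreducible_binomialPoly (F := AlgebraicClosure F) (α := φ ((1 - c) * w))
      (β := φ c) (α' := φ (-c * w ^ 2)) (β' := φ ((1 + c) * w)) (r := r) (k := p) (p := p)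
      (by
        rw [← map_mul, ← map_mul, ← map_sub, map_ne_zero,
          show -c * w ^ 2 * c - (1 - c) * w * ((1 + c) * w) = -w ^ 2 by ring]
        simpa using hw0)
      (by
        rw [hr, ← map_mul, ← map_add, map_eq_zero]
        field_simp
        ring)
      (by
        have hpF' : (p : AlgebraicClosure F) ≠ 0 := by
          have := (map_ne_zero φ).2 hpF
          rwa [map_natCast] at this
        exact mul_ne_zero ((map_ne_zero φ).2 (mul_ne_zero hc1' hw0))
          (mul_ne_zero hpF' (pow_ne_zero _ hr0)))
      hp.pos
    have hf : MvPolynomial.finSuccEquiv (AlgebraicClosure F) 1 (MvPolynomial.map φ f) =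
        binomialPoly (φ ((1 - c) * w)) (φ c) (φ (-c * w ^ 2)) (φ ((1 + c) * w)) p p := by
      have hX1 : MvPolynomial.finSuccEquiv (AlgebraicClosure F) 1 (MvPolynomial.X 1) =
          Polynomial.C (MvPolynomial.X 0) := MvPolynomial.finSuccEquiv_X_succ (j := 0)
      have hC : ∀ x : AlgebraicClosure F, MvPolynomial.finSuccEquiv (AlgebraicClosure F) 1
          (MvPolynomial.C x) = Polynomial.C (MvPolynomial.C x) := fun x => by
        simp [MvPolynomial.finSuccEquiv_apply]
      simp only [f, binomialPoly, map_sub, map_add, map_mul, map_pow, MvPolynomial.map_C,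
        MvPolynomial.map_X, hX1, hC, MvPolynomial.finSuccEquiv_X_zero]
    rw [← hf, MulEquiv.irreducible_iff] at hirr
    rw [Ideal.map_span, Set.image_singleton, Ideal.span_singleton_prime hirr.ne_zero]
    exact hirr.prime
  obtain ⟨a, ha⟩ := hF 2 _ hprime
  have hfa := ha f (Ideal.mem_span_singleton_self f)
  simp only [f, MvPolynomial.eval_sub, MvPolynomial.eval_add, MvPolynomial.eval_mul,
    MvPolynomial.eval_C, MvPolynomial.eval_X, MvPolynomial.eval_pow] at hfa
  -- Allowing `0` in `ZeroOrNotPow` means points of the curve with a zero coordinate need not be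
  -- avoided.
  have hZ : ∀ t : F, ZeroOrNotPow p (w * t ^ p) := fun t => by
    by_cases ht : t = 0
    · left
      rw [ht, zero_pow hp.ne_zero, mul_zero]
    · refine Or.inr fun ⟨y, hy⟩ => hw ⟨y / t, ?_⟩
      rw [div_pow, ← hy]
      field_simp
  exact ⟨w * a 1 ^ p, w * a 0 ^ p, hZ _, hZ _, by linear_combination -hfa⟩

theorem GoodResidueField.hasNonPowDifferences {p : ℕ} (hp : p.Prime) {F : Type*} [Field F] {ζ : F}
    (hζ : IsPrimitiveRoot ζ p) (hpF : (p : F) ≠ 0) (h : GoodResidueField p F) :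
    HasNonPowDifferences p F := by
  rcases h.2 with h | h | h
  · exact .of_finite hp hζ
  · exact .of_isPAC hp hζ hpF h.1 h.2
  · exact .of_isHilbertian hp hpF h

/-! ### The valuation ring is defined by the formula -/

/-- If all one-units are `p`-th powers, then the formula defines the valuation ring. -/
theorem exists_iff_mem_valuationSubring {K : Type*} [Field K] {O : ValuationSubring K} {p : ℕ}
    (hp : p ≠ 0) (hunit : ∀ a : K, O.valuation (a - 1) < 1 → ∃ y : K, a = y ^ p)
    (hF : HasNonPowDifferences p (IsLocalRing.ResidueField O)) (x : K) :
    (∃ a b : K, ZeroOrNotPow p a ∧ ZeroOrNotPow p b ∧ x * ((a - 1) * (b - 1)) = b - a) ↔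
      x ∈ O := by
  have hZ : ∀ a : K, ZeroOrNotPow p a → a - 1 ≠ 0 ∧ (a - 1)⁻¹ ∈ O := by
    rintro a (rfl | ha)
    · simp [O.neg_mem, O.one_mem]
    · have h1 : 1 ≤ O.valuation (a - 1) := by
        by_contra! h
        exact ha (hunit a h)
      refine ⟨fun h => ?_, ?_⟩
      · simp [h] at h1
      · rw [← O.valuation_le_one_iff, map_inv₀]
        exact inv_le_one_of_one_le₀ h1
  let π := IsLocalRing.residue O
  -- A `p`-th root of an element of `O` lies in `O`, so it reduces to a `p`-th root in the residue
  -- field.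
  have hlift : ∀ a : O, (¬ ∃ y, π a = y ^ p) → ¬ ∃ y : K, (a : K) = y ^ p := by
    rintro a ha ⟨y, hy⟩
    have hyO : y ∈ O := by
      rw [← O.valuation_le_one_iff, ← pow_le_one_iff hp, ← map_pow, ← hy]
      exact O.valuation_le_one a
    refine ha ⟨π ⟨y, hyO⟩, ?_⟩
    rw [← map_pow]
    exact congrArg π (Subtype.ext hy)
  have hπ : ∀ a : O, π a ≠ 0 → IsUnit a := fun a ha => by
    by_contra h
    exact ha ((IsLocalRing.residue_eq_zero_iff a).2 h)
  constructor
  · rintro ⟨a, b, ha, hb, e⟩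
    obtain ⟨ha1, ha⟩ := hZ a ha
    obtain ⟨hb1, hb⟩ := hZ b hb
    have : x = (a - 1)⁻¹ - (b - 1)⁻¹ := by
      field_simp
      linear_combination e
    rw [this]
    exact sub_mem ha hb
  · intro hx
    -- Only `m` is lifted freely, with `0` lifted to `0` itself; `a` is then forced by `x` and `b`.
    -- Its residue is `n`, so `n` must be a genuine non-power.
    have main : ∀ (x : O) (n m : IsLocalRing.ResidueField O), (¬ ∃ y, n = y ^ p) →
        ZeroOrNotPow p m → π x * ((n - 1) * (m - 1)) = m - n →
        ∃ a b : K, ZeroOrNotPow p a ∧ ZeroOrNotPow p b ∧ (x : K) * ((a - 1) * (b - 1)) = b - a := by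
      intro x n m hn hm e
      obtain ⟨b, rfl, hb⟩ : ∃ b : O, π b = m ∧ ZeroOrNotPow p (b : K) := by
        rcases hm with rfl | hm
        · exact ⟨0, map_zero π, Or.inl rfl⟩
        · obtain ⟨b, rfl⟩ := IsLocalRing.residue_surjective m
          exact ⟨b, rfl, Or.inr (hlift b hm)⟩
      -- If this residue vanished, `e` would give `π b = 1`, making the residue `1`.
      have hd : π (x * (b - 1) + 1) ≠ 0 := by
        intro h
        rw [map_add, map_mul, map_sub, map_one] at h
        have h2 : (n - 1) * (π x * (π b - 1) + 1) = π b - 1 := by linear_combination e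
        rw [h, mul_zero] at h2
        rw [← h2, mul_zero, zero_add] at h
        exact one_ne_zero h
      obtain ⟨u, hu⟩ := hπ _ hd
      let a : O := 1 + (b - 1) * ((u⁻¹ : Oˣ) : O)
      have hau : (a - 1) * (x * (b - 1) + 1) = b - 1 := by
        rw [← hu]
        simp [a, mul_assoc]
      have hπa : π a = n := by
        have h1 := congrArg π hau
        rw [map_mul, map_sub, map_sub, map_one] at h1
        refine sub_left_injective (b := (1 : IsLocalRing.ResidueField O)) (mul_right_cancel₀ hd (h1.trans ?_))
        simp only [map_add, map_mul, map_sub, map_one]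
        linear_combination -e
      refine ⟨a, b, Or.inr (hlift a (hπa ▸ hn)), hb, ?_⟩
      have := congrArg (Subtype.val : O → K) hau
      push_cast at this
      linear_combination this
    obtain ⟨⟨w, hw⟩, hc⟩ := hF
    by_cases hx0 : π ⟨x, hx⟩ = 0
    · exact main ⟨x, hx⟩ w w hw (Or.inr hw) (by rw [hx0]; ring)
    · obtain ⟨n, m, hn, hm, e⟩ := hc _ hx0
      -- If `n = 0`, then `m ≠ 0` because `c ≠ 0`; exchanging the two roles replaces `x` by `-x`.
      rcases hn with rfl | hn
      · rcases hm with rfl | hm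
        · exact absurd (by simpa using e) hx0
        · obtain ⟨a, b, ha, hb, e'⟩ := main (-⟨x, hx⟩) m 0 hm (Or.inl rfl)
            (by rw [map_neg]; linear_combination -e)
          exact ⟨b, a, hb, ha, by push_cast at e'; linear_combination -e'⟩
      · exact main ⟨x, hx⟩ n m hn hm e

/-! ### Transfer of the hypotheses to the residue field, and conclusion -/

theorem natCast_ne_zero_of_ringChar_ne {F : Type*} [Field F] {p : ℕ} (hp : p.Prime)
    (h : ringChar F ≠ p) : (p : F) ≠ 0 := by
  intro h0
  rcases (Nat.dvd_prime hp).1 ((ringChar.spec F p).1 h0) with h1 | h1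
  · exact CharP.ringChar_ne_one h1
  · exact h h1

theorem isPrimitiveRoot_of_ne_one {F : Type*} [Field F] {p : ℕ} (hp : p.Prime) {ζ : F}
    (h : ζ ^ p = 1) (h1 : ζ ≠ 1) : IsPrimitiveRoot ζ p := by
  have := Fact.mk hp
  rw [← orderOf_eq_prime h h1]
  exact IsPrimitiveRoot.orderOf ζ

/-- Shared by both parts of the theorem, which differ only in how `hunit` is obtained. `p` is a unit
because the residue characteristic is not `p`; then `1 - ζ` is a unit, so `ζ` stays primitive in the
residue field. -/
theorem definedSet_integralFormula {N : Set ℕ} {p : ℕ} (hpN : p ∈ N) (hp : p.Prime)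
    {K : Type u} [Field K] {Γ₀ : Type w} [LinearOrderedCommGroupWithZero Γ₀] {v : Valuation K Γ₀}
    {ζ : K} (hζ : IsPrimitiveRoot ζ p) (hF : GoodResidueField p (ResidueField v))
    (hunit : v.valuationSubring.valuation (p : K) = 1 →
      ∀ a : K, v.valuationSubring.valuation (a - 1) < 1 → ∃ y : K, a = y ^ p) :
    definedSet (integralFormula hpN) K = {x : K | v x ≤ 1} := by
  have hpF := natCast_ne_zero_of_ringChar_ne hp hF.1
  have hpO : v.valuationSubring.valuation (p : K) = 1 := by
    have h : IsUnit (p : v.valuationSubring) := by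
      by_contra h
      apply hpF
      rw [← map_natCast (IsLocalRing.residue v.valuationSubring)]
      exact (IsLocalRing.residue_eq_zero_iff _).2 h
    simpa using (v.valuationSubring.valuation_eq_one_iff _).1 h
  have hζO : ζ ∈ v.valuationSubring := by
    rw [← ValuationSubring.valuation_le_one_iff, ← pow_le_one_iff hp.ne_zero, ← map_pow,
      hζ.pow_eq_one, map_one]
  have hζF : IsPrimitiveRoot (IsLocalRing.residue v.valuationSubring ⟨ζ, hζO⟩) p := by
    refine isPrimitiveRoot_of_ne_one hp ?_ fun h => ?_
    · rw [← map_pow, show (⟨ζ, hζO⟩ : v.valuationSubring) ^ p = 1 from Subtype.ext hζ.pow_eq_one,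
        map_one]
    · refine not_valuation_one_sub_lt_one hp hζ hpO ?_
      have : IsLocalRing.residue v.valuationSubring (1 - ⟨ζ, hζO⟩) = 0 := by
        rw [map_sub, h, map_one, sub_self]
      rw [IsLocalRing.residue_eq_zero_iff] at this
      exact (v.valuationSubring.valuation_lt_one_iff _).1 this
  ext x
  rw [mem_definedSet_integralFormula,
    exists_iff_mem_valuationSubring hp.ne_zero (hunit hpO) (hF.hasNonPowDifferences hp hζF hpF)]
  rfl

end PHens

theorem mainTheorem1 :
    (∀ p : ℕ, p.Prime →
      ∃ φ : (PHens.ringPow {p}).Formula (Fin 1), φ.IsExistential ∧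
        ∀ (K : Type u) [Field K] (Γ₀ : Type w) [LinearOrderedCommGroupWithZero Γ₀]
          (v : Valuation K Γ₀),
          PHens.IsPHenselian p v → (∃ ζ : K, IsPrimitiveRoot ζ p) →
          PHens.GoodResidueField p (PHens.ResidueField v) →
          PHens.definedSet φ K = {x : K | v x ≤ 1}) ∧
    (∃ φ : PHens.macintyre.Formula (Fin 1), φ.IsExistential ∧
      ∀ (K : Type u) [Field K] (Γ₀ : Type w) [LinearOrderedCommGroupWithZero Γ₀]
        (v : Valuation K Γ₀),
        PHens.IsHenselian v →
        PHens.GoodResidueField 2 (PHens.ResidueField v) →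
        PHens.definedSet φ K = {x : K | v x ≤ 1}) := by
  refine ⟨fun p hp => ⟨PHens.integralFormula (N := {p}) rfl,
    PHens.isExistential_integralFormula _, fun K _ Γ₀ _ v hv ⟨ζ, hζ⟩ hF =>
      PHens.definedSet_integralFormula _ hp hζ hF fun hpO a ha =>
        hv.exists_pow_eq hp hζ hpO ha⟩,
    PHens.integralFormula (p := 2) (show 2 ∈ ({n | 0 < n} : Set ℕ) by simp),
    PHens.isExistential_integralFormula _,
    fun K _ Γ₀ _ v hv hF => ?_⟩
  have h2 : (2 : K) ≠ 0 := by
    intro h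
    apply PHens.natCast_ne_zero_of_ringChar_ne Nat.prime_two hF.1
    rw [← map_natCast (IsLocalRing.residue v.valuationSubring),
      show ((2 : ℕ) : v.valuationSubring) = 0 from Subtype.ext (by push_cast; exact h), map_zero]
  -- For `p = 2` the root of unity is `-1`, available since `2 ≠ 0` in `K`. The one-unit argument
  -- then runs directly in the algebraic closure, without passing through `K(2)`.
  have hζ := PHens.isPrimitiveRoot_of_ne_one Nat.prime_two (by norm_num : (-1 : K) ^ 2 = 1)
    fun h => h2 (by linear_combination -h)
  refine PHens.definedSet_integralFormula _ Nat.prime_two hζ hF fun hpO a ha => ?_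
  obtain ⟨α, hα⟩ := IsAlgClosed.exists_pow_nat_eq (algebraMap K (AlgebraicClosure K) a) two_pos
  exact PHens.exists_pow_eq_of_hasUniqueExtension hv Nat.prime_two hζ hpO ha hα
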